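/- Let $G=(V,E)$ be a finite undirected graph, where parallel edges and loops are allowed. In $\mathbb{R}^{|V|+|E|}$ with standard basis vectors $\mathbf{x}_u$ ($u\in V$) and $\mathbf{y}_e$ ($e\in E$), put, for an edge $e$ with ends $u$ and $w$, $$p_e=-\mathbf{y}_e+\mathbf{x}_u+\mathbf{x}_w,\qquad p_{e,u}=\mathbf{y}_e+\mathbf{x}_u-\mathbf{x}_w,\qquad p_{e,w}=\mathbf{y}_e-\mathbf{x}_u+\mathbf{x}_w .$$ The cosmological polytope $P_G$ is the convex hull of all the points $p_e,p_{e,u},p_{e,w}$ for $e=\{u,w\}\in E$ together with all the points $\mathbf{x}_u$ for $u\in V$. A face of a polytope is the set of its points that maximize some linear functional; the empty set is also counted as a face. Let $v\in V$ be a vertex, and let $e_1,\dots,e_d$ be the distinct edges of $G$ incident to $v$ (a loop at $v$ is listed once, so that $d$ is the degree of $v$ if there is no loop at $v$). Assume $d\ge 1$. Then $$F_v=\operatorname{conv}\{p_{e_1},p_{e_1,v},\dots,p_{e_d},p_{e_d,v}\}$$ is a face of $P_G$ of dimension $d$, the $2d$ points $p_{e_1},p_{e_1,v},\dots,p_{e_d},p_{e_d,v}$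 are pairwise distinct, and they are exactly the vertices of $F_v$. Moreover, $F_v$ is affinely equivalent to the $d$-dimensional cross-polytope $\operatorname{conv}\{\pm \mathbf{e}_1,\dots,\pm \mathbf{e}_d\}\subset\mathbb{R}^d$ (some affine map from $\mathbb{R}^{|V|+|E|}$ to $\mathbb{R}^d$ restricts to a bijection between the two polytopes), and it is combinatorially equivalent to it (their posets of faces, ordered by inclusion, are isomorphic). -/

import Mathlib

open scoped Graph

namespace Cosmological

noncomputable section

variable {α β : Type*}

/-- The space `ℝ^{|V|+|E|}` in which the cosmological polytope of the (multi)graph `G` lives. -/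
abbrev Space (G : Graph α β) : Type _ := (V(G) ⊕ E(G)) → ℝ

open Classical in
/-- The standard basis vector `x_v` of a vertex `v`. -/
def xvec (G : Graph α β) (v : V(G)) : Space G := Pi.single (Sum.inl v) 1

open Classical in
/-- The standard basis vector `y_e` of an edge `e`. -/
def yvec (G : Graph α β) (e : E(G)) : Space G := Pi.single (Sum.inr e) 1

/-- The point `p_e = -y_e + x_v + x_w`, where `v`, `w` are the ends of the edge `e`. -/
def edgePoint (G : Graph α β) (e : E(G)) (v w : V(G)) : Space G :=
  -yvec G e + xvec G v + xvec G w

/-- The point `p_{e,v} = y_e + x_v - x_w`, where `v`, `w` are the ends of the edge `e`. -/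
def endPoint (G : Graph α β) (e : E(G)) (v w : V(G)) : Space G :=
  yvec G e + xvec G v - xvec G w

/-- The cosmological polytope `P_G`: the convex hull of the points `p_e`, `p_{e,v}`, `p_{e,w}` over
all edges `e` with ends `v`, `w`, and of the points `x_v` over all vertices `v`. Both orders of the
ends of an edge are allowed in the union, so both `p_{e,v}` and `p_{e,w}` occur in it. -/
def cosmologicalPolytope (G : Graph α β) : Set (Space G) :=
  convexHull ℝ
    ({p | ∃ (e : E(G)) (v w : V(G)), G.IsLink (e : β) (v : α) (w : α) ∧
        (p = edgePoint G e v w ∨ p = endPoint G e v w)} ∪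
      Set.range (xvec G))

/-- The points `p_e` and `p_{e,v}` over all edges `e` incident to the fixed vertex `v`. -/
def vertexFacePoints (G : Graph α β) (v : V(G)) : Set (Space G) :=
  {p | ∃ (e : E(G)) (w : V(G)), G.IsLink (e : β) (v : α) (w : α) ∧
      (p = edgePoint G e v w ∨ p = endPoint G e v w)}

/-- The vertex face `F_v`. -/
def vertexFace (G : Graph α β) (v : V(G)) : Set (Space G) :=
  convexHull ℝ (vertexFacePoints G v)

/-- The standard `d`-dimensional cross-polytope, the convex hull of `±e_1, …, ±e_d` in `ℝ^d`. -/
def crossPolytope (d : ℕ) : Set (Fin d → ℝ) :=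
  convexHull ℝ {p | ∃ i : Fin d, p = Pi.single i 1 ∨ p = -Pi.single i 1}

/-- Affine equivalence of polytopes: some affine map between the ambient spaces restricts to a
bijection between the points of the two polytopes. -/
def AffinelyEquivalent {E E' : Type*} [AddCommGroup E] [Module ℝ E] [AddCommGroup E'] [Module ℝ E']
    (P : Set E) (Q : Set E') : Prop :=
  ∃ f : E →ᵃ[ℝ] E', Set.BijOn f P Q

/-- The face poset of a polytope, ordered by inclusion (the empty face is included). A nonempty face
is the set of all points of the polytope that maximize some linear functional. -/
abbrev FacePoset {E : Type*} [AddCommGroup E] [Module ℝ E] [TopologicalSpace E] (P : Set E) :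
    Type _ :=
  {F : Set E // IsExposed ℝ P F}

/-- Combinatorial equivalence of polytopes: their face posets are isomorphic. -/
def CombinatoriallyEquivalent {E E' : Type*} [AddCommGroup E] [Module ℝ E] [TopologicalSpace E]
    [AddCommGroup E'] [Module ℝ E'] [TopologicalSpace E'] (P : Set E) (Q : Set E') : Prop :=
  Nonempty (FacePoset P ≃o FacePoset Q)

end

end Cosmological

/-! Writing `p_e = x_v + (x_w - y_e)` and `p_{e,v} = x_v - (x_w - y_e)` shows that the generators of
`F_v` come in pairs symmetric about `x_v`. The vectors `x_w - y_e` are independent, since each has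
its own `y_e` coordinate, so `F_v` is an injective affine image of the cross-polytope
(`exists_vertexFacePoints_eq_image`). Vertices, their number, dimension and face poset are all
transported along this map.

That `F_v` is a face is seen from the `x_v` coordinate, corrected by `y_e` for loops at `v`: it is 1
on `F_v` and less than 1 at every generator outside it (`isExposed_vertexFace`). -/

namespace Cosmological

open Set

/-! ### Exposed faces and affine embeddings -/

section Faces

variable {E E' : Type*} [AddCommGroup E] [Module ℝ E] [TopologicalSpace E]
  [AddCommGroup E'] [Module ℝ E'] [TopologicalSpace E']

/-- If a linear functional is at most `1` on `S`, with value `1` exactly at the points of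
`S ∩ convexHull ℝ T`, and `T ⊆ S`, then the convex hull of `T` is an exposed face of that of `S`. -/
theorem isExposed_convexHull_of_le_one (l : E →L[ℝ] ℝ) {S T : Set E} (hTS : T ⊆ S)
    (hT : ∀ x ∈ T, l x = 1) (hS : ∀ x ∈ S, l x < 1 ∨ x ∈ convexHull ℝ T) :
    IsExposed ℝ (convexHull ℝ S) (convexHull ℝ T) := by
  have hT' : ∀ x ∈ convexHull ℝ T, l x = 1 := fun x hx =>
    convexHull_min hT (convex_hyperplane (r := 1) l.toLinearMap.isLinear) hx
  -- With both weights positive, the value 1 is reached only if both endpoints have it, and then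
  -- both lie in the hull of `T`.
  have hconv : Convex ℝ {x | l x < 1 ∨ x ∈ convexHull ℝ T} := by
    rintro x hx y hy a b ha hb hab
    have key : ∀ z, (l z < 1 ∨ z ∈ convexHull ℝ T) → l z ≤ 1 := fun z hz =>
      hz.elim le_of_lt fun h => (hT' z h).le
    rcases ha.eq_or_lt with rfl | ha
    · obtain rfl : b = 1 := by linarith
      simpa using hy
    rcases hb.eq_or_lt with rfl | hb
    · obtain rfl : a = 1 := by linarith
      simpa using hx
    have hlx := key x hx
    have hly := key y hy
    simp only [mem_ofPred_eq, map_add, map_smul, smul_eq_mul] at hx hy ⊢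
    rcases hx with hx | hx
    · left; nlinarith
    rcases hy with hy | hy
    · left; nlinarith
    · exact Or.inr (convex_convexHull ℝ T hx hy ha.le hb.le hab)
  have hS' : ∀ x ∈ convexHull ℝ S, l x < 1 ∨ x ∈ convexHull ℝ T := fun x hx =>
    convexHull_min hS hconv hx
  rintro ⟨z, hz⟩
  refine ⟨l, Subset.antisymm (fun x hx => ⟨convexHull_mono hTS hx, fun y hy => ?_⟩) ?_⟩
  · rw [hT' x hx]
    exact (hS' y hy).elim le_of_lt fun h => (hT' y h).le
  · rintro x ⟨hx, hmax⟩
    refine (hS' x hx).resolve_left fun h => ?_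
    have := hmax z (convexHull_mono hTS hz)
    rw [hT' z hz] at this
    linarith

/-- A functional `l` is transported to `l ∘ M`; the translation by `c` only adds the constant `l (M
c)`. -/
theorem isExposed_image_add_apply {c : E} {L : E' →L[ℝ] E} {M : E →L[ℝ] E'}
    (hML : ∀ t, M (L t) = t) {Q B : Set E'} (h : IsExposed ℝ Q B) :
    IsExposed ℝ ((fun t => c + L t) '' Q) ((fun t => c + L t) '' B) := by
  rintro ⟨_, t₀, ht₀, rfl⟩
  obtain ⟨l, rfl⟩ := h ⟨t₀, ht₀⟩
  refine ⟨l.comp M, ?_⟩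
  ext x
  constructor
  · rintro ⟨t, ⟨htQ, ht⟩, rfl⟩
    refine ⟨⟨t, htQ, rfl⟩, ?_⟩
    rintro _ ⟨s, hs, rfl⟩
    simpa [hML] using ht s hs
  · rintro ⟨⟨t, htQ, rfl⟩, ht⟩
    refine ⟨t, ⟨htQ, fun s hs => ?_⟩, rfl⟩
    simpa [hML] using ht _ ⟨s, hs, rfl⟩

theorem isExposed_preimage_add_apply {c : E} {L : E' →L[ℝ] E} {Q : Set E'} {F : Set E}
    (hL : Function.Injective L) (h : IsExposed ℝ ((fun t => c + L t) '' Q) F) :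
    IsExposed ℝ Q ((fun t => c + L t) ⁻¹' F) := by
  rintro ⟨t₀, ht₀⟩
  obtain ⟨l, rfl⟩ := h ⟨_, ht₀⟩
  refine ⟨l.comp L, ?_⟩
  ext t
  constructor
  · rintro ⟨⟨t', ht', he⟩, ht⟩
    obtain rfl : t' = t := hL (add_left_cancel he)
    refine ⟨ht', fun s hs => ?_⟩
    simpa using ht _ ⟨s, hs, rfl⟩
  · rintro ⟨htQ, ht⟩
    refine ⟨⟨t, htQ, rfl⟩, ?_⟩
    rintro _ ⟨s, hs, rfl⟩
    simpa using ht s hs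

/-- The face poset of a set is isomorphic to that of its image under an affine map that has a
continuous linear retraction. -/
theorem combinatoriallyEquivalent_image_add_apply (c : E) {L : E' →L[ℝ] E} {M : E →L[ℝ] E'}
    (hML : ∀ t, M (L t) = t) (Q : Set E') :
    CombinatoriallyEquivalent ((fun t => c + L t) '' Q) Q := by
  have hL : Function.Injective L := Function.LeftInverse.injective hML
  have hg : Function.Injective fun t => c + L t := (add_right_injective c).comp hL
  have himg : ∀ F : FacePoset ((fun t => c + L t) '' Q),
      (fun t => c + L t) '' ((fun t => c + L t) ⁻¹' F.1) = F.1 := fun F =>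
    image_preimage_eq_of_subset (F.2.subset.trans (image_subset_range _ _))
  refine ⟨⟨⟨fun F => ⟨_, isExposed_preimage_add_apply hL F.2⟩, fun B => ⟨_, isExposed_image_add_apply hML B.2⟩,
    fun F => Subtype.ext (himg F), fun B => Subtype.ext (preimage_image_eq _ hg)⟩, ?_⟩⟩
  intro F F'
  change (fun t => c + L t) ⁻¹' F.1 ⊆ (fun t => c + L t) ⁻¹' F'.1 ↔ F.1 ⊆ F'.1
  refine ⟨fun h => ?_, fun h => preimage_mono h⟩
  rw [← himg F, ← himg F']
  exact image_mono h

end Faces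

/-! ### Vertices and dimension of the cross-polytope -/

section CrossPolytope

variable {d : ℕ}

/-- The points `±e_i`. -/
def crossPoints (d : ℕ) : Set (Fin d → ℝ) :=
  {p | ∃ i : Fin d, p = Pi.single i 1 ∨ p = -Pi.single i 1}

theorem sum_abs_le_one_of_mem_crossPolytope {x : Fin d → ℝ} (hx : x ∈ crossPolytope d) :
    ∑ i, |x i| ≤ 1 := by
  have hconv : Convex ℝ {x : Fin d → ℝ | ∑ i, |x i| ≤ 1} := by
    intro x hx y hy a b ha hb hab
    calc ∑ i, |(a • x + b • y) i| ≤ ∑ i, (a * |x i| + b * |y i|) := by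
          refine Finset.sum_le_sum fun i _ => ?_
          simpa [abs_mul, abs_of_nonneg ha, abs_of_nonneg hb] using abs_add_le (a * x i) (b * y i)
      _ = a * ∑ i, |x i| + b * ∑ i, |y i| := by
          rw [Finset.sum_add_distrib, Finset.mul_sum, Finset.mul_sum]
      _ ≤ 1 := by
          simp only [mem_ofPred_eq] at hx hy
          nlinarith
  refine convexHull_min ?_ hconv hx
  rintro _ ⟨i, rfl | rfl⟩ <;> simp [Pi.single_apply, apply_ite abs]

/-- A coordinate of absolute value 1 exhausts the `ℓ¹` bound, so the others vanish. -/
theorem eq_single_of_mem_crossPolytope {x : Fin d → ℝ} (hx : x ∈ crossPolytope d) {i : Fin d}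
    {s : ℝ} (hs : |s| = 1) (hi : x i = s) : x = Pi.single i s := by
  have h := sum_abs_le_one_of_mem_crossPolytope hx
  rw [← Finset.add_sum_erase _ _ (Finset.mem_univ i), hi, hs] at h
  have h0 : ∑ j ∈ Finset.univ.erase i, |x j| = 0 :=
    le_antisymm (by linarith) (Finset.sum_nonneg fun _ _ => abs_nonneg _)
  rw [Finset.sum_eq_zero_iff_of_nonneg fun _ _ => abs_nonneg _] at h0
  ext j
  by_cases hj : j = i
  · subst hj; simpa using hi
  · simpa [hj] using h0 j (by simp [hj])

theorem abs_apply_le_one_of_mem_crossPolytope {x : Fin d → ℝ} (hx : x ∈ crossPolytope d)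
    (i : Fin d) : |x i| ≤ 1 :=
  (Finset.single_le_sum (fun j _ => abs_nonneg (x j)) (Finset.mem_univ i)).trans
    (sum_abs_le_one_of_mem_crossPolytope hx)

theorem extremePoints_crossPolytope : (crossPolytope d).extremePoints ℝ = crossPoints d := by
  refine Subset.antisymm extremePoints_convexHull_subset ?_
  rintro p hp
  refine ⟨subset_convexHull ℝ _ hp, ?_⟩
  rintro x hx y hy ⟨a, b, ha, hb, hab, hxy⟩
  obtain ⟨i, rfl | rfl⟩ := hp
  · have hi : a * x i + b * y i = 1 := by simpa using congrFun hxy i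
    have h1 := (abs_le.1 (abs_apply_le_one_of_mem_crossPolytope hx i)).2
    have h2 := (abs_le.1 (abs_apply_le_one_of_mem_crossPolytope hy i)).2
    exact eq_single_of_mem_crossPolytope hx (by simp) (by nlinarith)
  · have hi : a * x i + b * y i = -1 := by simpa using congrFun hxy i
    have h1 := (abs_le.1 (abs_apply_le_one_of_mem_crossPolytope hx i)).1
    have h2 := (abs_le.1 (abs_apply_le_one_of_mem_crossPolytope hy i)).1
    rw [← Pi.single_neg]
    exact eq_single_of_mem_crossPolytope hx (by simp) (by nlinarith)

theorem ncard_crossPoints : (crossPoints d).ncard = 2 * d := by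
  have h : crossPoints d = range fun p : Fin d × Bool =>
      (Pi.single p.1 (if p.2 then 1 else -1) : Fin d → ℝ) := by
    ext x
    constructor
    · rintro ⟨i, rfl | rfl⟩
      · exact ⟨(i, true), by simp⟩
      · exact ⟨(i, false), by simp [Pi.single_neg]⟩
    · rintro ⟨⟨i, _ | _⟩, rfl⟩
      · exact ⟨i, by simp [Pi.single_neg]⟩
      · exact ⟨i, by simp⟩
  have hinj : Function.Injective fun p : Fin d × Bool =>
      (Pi.single p.1 (if p.2 then 1 else -1) : Fin d → ℝ) := by
    rintro ⟨i, a⟩ ⟨j, b⟩ hij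
    have h1 := congrFun hij i
    by_cases hne : i = j
    · subst hne
      cases a <;> cases b <;> first | rfl | norm_num at h1
    · cases a <;> simp [hne] at h1
  rw [h, ← image_univ, ncard_image_of_injective _ hinj, ncard_univ]
  simp [Nat.card_eq_fintype_card, mul_comm]

theorem vectorSpan_crossPolytope : vectorSpan ℝ (crossPolytope d) = ⊤ := by
  rw [eq_top_iff, ← (Pi.basisFun ℝ (Fin d)).span_eq, Submodule.span_le]
  rintro _ ⟨i, rfl⟩
  have h1 : (Pi.single i 1 : Fin d → ℝ) ∈ crossPolytope d :=
    subset_convexHull ℝ _ ⟨i, Or.inl rfl⟩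
  have h2 : (-Pi.single i 1 : Fin d → ℝ) ∈ crossPolytope d :=
    subset_convexHull ℝ _ ⟨i, Or.inr rfl⟩
  have h := (vectorSpan ℝ (crossPolytope d)).smul_mem (1 / 2 : ℝ)
    (vsub_mem_vectorSpan ℝ h1 h2)
  have he : (1 / 2 : ℝ) • ((Pi.single i 1 : Fin d → ℝ) -ᵥ -Pi.single i 1) = Pi.single i 1 := by
    rw [vsub_eq_sub, sub_neg_eq_add, ← two_smul ℝ, smul_smul]
    norm_num
  rw [he] at h
  simpa using h

end CrossPolytope

/-! ### The vertex face as a face and as a cross-polytope -/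

section VertexFace

variable {α β : Type*} {G : Graph α β}

theorem edgePoint_eq (e : E(G)) (v w : V(G)) :
    edgePoint G e v w = xvec G v + (xvec G w - yvec G e) := by
  unfold edgePoint; abel

theorem endPoint_eq (e : E(G)) (v w : V(G)) :
    endPoint G e v w = xvec G v + -(xvec G w - yvec G e) := by
  unfold endPoint; abel

/-- A vertex incident to some edge lies in its vertex face, as the midpoint of `p_e` and
`p_{e,v}`. -/
theorem xvec_mem_vertexFace {v w : V(G)} {e : E(G)} (h : G.IsLink (e : β) (v : α) (w : α)) :
    xvec G v ∈ vertexFace G v := by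
  have h1 : edgePoint G e v w ∈ vertexFace G v :=
    subset_convexHull ℝ _ ⟨e, w, h, Or.inl rfl⟩
  have h2 : endPoint G e v w ∈ vertexFace G v :=
    subset_convexHull ℝ _ ⟨e, w, h, Or.inr rfl⟩
  have := (convex_convexHull ℝ (vertexFacePoints G v)).midpoint_mem h1 h2
  rwa [edgePoint_eq, endPoint_eq, ← sub_eq_add_neg, midpoint_add_sub] at this

open Classical in
/-- The functional that exposes the vertex face of `v`: the sum of the coordinates of `x_v` and of
the `y_e` over all loops `e` at `v`. -/
theorem exists_supporting_functional [Finite E(G)] (v : V(G)) :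
    ∃ l : Space G →L[ℝ] ℝ, (∀ w, l (xvec G w) = if w = v then 1 else 0) ∧
      ∀ e : E(G), l (yvec G e) = if G.IsLoopAt (e : β) (v : α) then 1 else 0 := by
  have := Fintype.ofFinite E(G)
  refine ⟨ContinuousLinearMap.proj (R := ℝ) (φ := fun _ : V(G) ⊕ E(G) => ℝ) (Sum.inl v) +
    ∑ e : E(G), (if G.IsLoopAt (e : β) (v : α) then (1 : ℝ) else 0) •
      ContinuousLinearMap.proj (R := ℝ) (φ := fun _ : V(G) ⊕ E(G) => ℝ) (Sum.inr e), ?_, ?_⟩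
  · intro w
    simp [xvec, Pi.single_apply, eq_comm, -ite_smul]
  · intro e
    simp [yvec, Pi.single_apply, -ite_smul]

theorem isExposed_vertexFace [Finite E(G)] {v : V(G)} (hv : ∃ e, G.Inc e (v : α)) :
    IsExposed ℝ (cosmologicalPolytope G) (vertexFace G v) := by
  classical
  obtain ⟨l, hx, hy⟩ := exists_supporting_functional v
  obtain ⟨e₀, w₀, h₀⟩ := hv
  have hlink : ∀ {e : E(G)} {w : V(G)}, G.IsLink (e : β) (v : α) (w : α) →
      (G.IsLoopAt (e : β) (v : α) ↔ w = v) := fun {e w} h =>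
    ⟨fun h' => Subtype.ext (h.right_unique h'), by rintro rfl; exact h⟩
  refine isExposed_convexHull_of_le_one l ?_ ?_ ?_
  · rintro p ⟨e, w, h, hp⟩
    exact Or.inl ⟨e, v, w, h, hp⟩
  · rintro p ⟨e, w, h, rfl | rfl⟩
    -- For a loop, `p_e = 2x_v - y_e` has value `2 - 1` and `p_{e,v} = y_e` has value 1.
    · simp [edgePoint_eq, hx, hy, hlink h]
    · simp [endPoint_eq, hx, hy, hlink h]
  · rintro p (⟨e, a, b, h, hp⟩ | ⟨w, rfl⟩)
    · by_cases ha : a = v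
      · subst ha
        exact Or.inr (subset_convexHull ℝ _ ⟨e, b, h, hp⟩)
      have hloop : ¬ G.IsLoopAt (e : β) (v : α) := fun h' => by
        rcases h.left_eq_or_eq h' with h'' | h'' <;> exact ha (Subtype.ext h'')
      by_cases hb : b = v
      · subst hb
        rcases hp with rfl | rfl
        · refine Or.inr (subset_convexHull ℝ _ ⟨e, a, h.symm, Or.inl ?_⟩)
          unfold edgePoint; abel
        -- This is `p_{e,a}` for an edge from `a ≠ v` to `v`, with value -1.
        · left
          simp [endPoint, hx, hy, hloop, ha]
      · left
        rcases hp with rfl | rfl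
        · simp [edgePoint, hx, hy, hloop, ha, hb]
        · simp [endPoint, hx, hy, hloop, ha, hb]
    · by_cases hw : w = v
      · subst hw
        exact Or.inr (xvec_mem_vertexFace (e := ⟨e₀, h₀.edge_mem⟩) (w := ⟨w₀, h₀.right_mem⟩) h₀)
      · left
        simp [hx, hw]

/-- The points of the vertex face, centred at `x_v`, correspond to the points `±e_i` under a linear
map with a linear retraction. -/
theorem exists_vertexFacePoints_eq_image [Finite E(G)] {v : V(G)} {d : ℕ}
    (hd : {e : β | G.Inc e (v : α)}.ncard = d) :
    ∃ (L : (Fin d → ℝ) →L[ℝ] Space G) (M : Space G →L[ℝ] (Fin d → ℝ)),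
      (∀ t, M (L t) = t) ∧ M (xvec G v) = 0 ∧
      vertexFacePoints G v = (fun t => xvec G v + L t) '' crossPoints d := by
  classical
  have hfin : {e : β | G.Inc e (v : α)}.Finite :=
    (toFinite E(G)).subset fun e he => he.edge_mem
  have : Finite {e : β | G.Inc e (v : α)} := hfin
  have φ : Fin d ≃ {e : β | G.Inc e (v : α)} :=
    (Finite.equivFinOfCardEq (by rw [Nat.card_coe_set_eq, hd])).symm
  choose ω hω using fun i => (φ i).2
  let ε : Fin d → E(G) := fun i => ⟨φ i, (hω i).edge_mem⟩
  let τ : Fin d → V(G) := fun i => ⟨ω i, (hω i).right_mem⟩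
  have hε : Function.Injective ε := fun i j hij =>
    φ.injective (Subtype.ext (congrArg (fun e : E(G) => (e : β)) hij))
  let L : (Fin d → ℝ) →L[ℝ] Space G := ∑ i,
    (ContinuousLinearMap.proj (R := ℝ) (φ := fun _ : Fin d => ℝ) i).smulRight
      (xvec G (τ i) - yvec G (ε i))
  -- Among the images of the basis vectors, only that of `e_i` involves `y_{ε i}`, with coefficient
  -- -1.
  let M : Space G →L[ℝ] (Fin d → ℝ) := ContinuousLinearMap.pi fun i =>
    -ContinuousLinearMap.proj (R := ℝ) (φ := fun _ : V(G) ⊕ E(G) => ℝ) (Sum.inr (ε i))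
  have hL : ∀ i, L (Pi.single i 1) = xvec G (τ i) - yvec G (ε i) := fun i => by
    simp [L, Pi.single_apply, ite_smul]
  refine ⟨L, M, fun t => ?_, ?_, ?_⟩
  · ext j
    simp [L, M, xvec, yvec, Pi.single_apply, hε.eq_iff]
  · ext j
    simp [M, xvec]
  · ext p
    constructor
    · rintro ⟨e, w, h, hp⟩
      obtain ⟨i, hi⟩ := φ.surjective ⟨e, (⟨w, h⟩ : G.Inc (e : β) (v : α))⟩
      have he : ε i = e := Subtype.ext (congrArg (fun e : {e : β | G.Inc e (v : α)} => (e : β)) hi)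
      have hlink : G.IsLink (e : β) (v : α) (τ i : α) := by rw [← he]; exact hω i
      have hw : τ i = w := Subtype.ext (hlink.right_unique h)
      rcases hp with rfl | rfl
      · exact ⟨_, ⟨i, Or.inl rfl⟩, by simp only [hL, edgePoint_eq, he, hw]⟩
      · exact ⟨_, ⟨i, Or.inr rfl⟩, by simp only [map_neg, hL, endPoint_eq, he, hw]⟩
    · rintro ⟨_, ⟨i, rfl | rfl⟩, rfl⟩
      · exact ⟨ε i, τ i, hω i, Or.inl (by simp only [hL, edgePoint_eq])⟩
      · exact ⟨ε i, τ i, hω i, Or.inr (by simp only [map_neg, hL, endPoint_eq])⟩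

end VertexFace

end Cosmological

theorem proposition3p5 {α β : Type*} (G : Graph α β) [Finite V(G)] [Finite E(G)]
    (v : V(G)) (d : ℕ) (hd : {e : β | G.Inc e (v : α)}.ncard = d) (hd1 : 1 ≤ d) :
    IsExposed ℝ (Cosmological.cosmologicalPolytope G) (Cosmological.vertexFace G v) ∧
    (Cosmological.vertexFace G v).extremePoints ℝ = Cosmological.vertexFacePoints G v ∧
    (Cosmological.vertexFacePoints G v).ncard = 2 * d ∧
    Module.finrank ℝ (vectorSpan ℝ (Cosmological.vertexFace G v)) = d ∧
    Cosmological.AffinelyEquivalent (Cosmological.vertexFace G v)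
      (Cosmological.crossPolytope d) ∧
    Cosmological.CombinatoriallyEquivalent (Cosmological.vertexFace G v)
      (Cosmological.crossPolytope d) := by
  have hinc : ∃ e, G.Inc e (v : α) :=
    Set.nonempty_of_ncard_ne_zero (s := {e : β | G.Inc e (v : α)}) (by omega)
  obtain ⟨L, M, hML, hMv, hpts⟩ := Cosmological.exists_vertexFacePoints_eq_image hd
  have hL : Function.Injective L := Function.LeftInverse.injective hML
  let g : (Fin d → ℝ) →ᵃ[ℝ] Cosmological.Space G :=
    AffineMap.const ℝ (Fin d → ℝ) (Cosmological.xvec G v) + L.toLinearMap.toAffineMap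
  have hg : (g : (Fin d → ℝ) → Cosmological.Space G) = fun t => Cosmological.xvec G v + L t := rfl
  have hgL : g.linear = L.toLinearMap := by ext; simp [g]
  have hginj : Function.Injective g := (add_right_injective (Cosmological.xvec G v)).comp hL
  have hface : Cosmological.vertexFace G v = g '' Cosmological.crossPolytope d := by
    rw [Cosmological.vertexFace, hpts, ← hg, ← AffineMap.image_convexHull]
    rfl
  refine ⟨Cosmological.isExposed_vertexFace hinc, ?_, ?_, ?_, ?_, ?_⟩
  · rw [hpts, hface, ← hg, ← Cosmological.extremePoints_crossPolytope]
    ext x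
    constructor
    · rintro ⟨⟨t, ht, rfl⟩, hext⟩
      refine ⟨t, ⟨ht, fun a ha b hb hab => ?_⟩, rfl⟩
      refine hginj (hext ⟨a, ha, rfl⟩ ⟨b, hb, rfl⟩ ?_)
      rw [← image_openSegment]
      exact ⟨t, hab, rfl⟩
    · rintro ⟨t, ⟨ht, hext⟩, rfl⟩
      refine ⟨⟨t, ht, rfl⟩, ?_⟩
      rintro _ ⟨a, ha, rfl⟩ _ ⟨b, hb, rfl⟩ hab
      rw [← image_openSegment, hginj.mem_set_image] at hab
      rw [hext ha hb hab]
  · rw [hpts, ← hg, Set.ncard_image_of_injective _ hginj, Cosmological.ncard_crossPoints]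
  · rw [hface, ← AffineMap.map_vectorSpan,
      Cosmological.vectorSpan_crossPolytope, hgL, Submodule.map_top,
      LinearMap.finrank_range_of_inj hL]
    simp
  -- `M` kills `x_v`, so it inverts `g` without a translation.
  · refine ⟨M.toLinearMap.toAffineMap, ?_⟩
    have hMg : ∀ t, M (g t) = t := fun t => by simp [hg, hML, hMv]
    rw [hface]
    refine ⟨?_, ?_, ?_⟩
    · rintro _ ⟨t, ht, rfl⟩
      simpa [hMg] using ht
    · rintro _ ⟨t, ht, rfl⟩ _ ⟨s, hs, rfl⟩ h
      have h : M (g t) = M (g s) := h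
      rw [hMg, hMg] at h
      rw [h]
    · intro t ht
      exact ⟨g t, ⟨t, ht, rfl⟩, hMg t⟩
  · rw [hface, hg]
    exact Cosmological.combinatoriallyEquivalent_image_add_apply _ hML _
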